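/- Let $B_\bullet$ be the group of parenthesized braids, given by the presentation with generators $\sigma_i, a_i$ ($i\ge 1$) and, for all $i\ge 1$ and $j\ge i+2$, the relations $$\sigma_i\sigma_j=\sigma_j\sigma_i,\quad \sigma_i a_j=a_j\sigma_i,\quad a_i a_{j-1}=a_j a_i,\quad a_i\sigma_{j-1}=\sigma_j a_i,$$ $$\sigma_i\sigma_{i+1}\sigma_i=\sigma_{i+1}\sigma_i\sigma_{i+1},\quad \sigma_{i+1}\sigma_i a_{i+1}=a_i\sigma_i,\quad \sigma_i\sigma_{i+1}a_i=a_{i+1}\sigma_i.$$ Let $\partial$ be the endomorphism of $B_\bullet$ that maps $\sigma_i$ to $\sigma_{i+1}$ and $a_i$ to $a_{i+1}$ for every $i\ge1$, and for $x,y\in B_\bullet$ put $$x[y]=x\cdot\partial y\cdot\sigma_1\cdot(\partial x)^{-1},\qquad x\circ y=x\cdot\partial y\cdot a_1.$$ Then $B_\bullet$ equipped with these two operations is an augmented LD-system, that is, for all $x,y,z\in B_\bullet$, $$x[y[z]]=x[y]\,[\,x[z]\,],\qquad x[y[z]]=(x\circ y)[z],\qquad x[y\circ z]=x[y]\circ x[z].$$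 Moreover the bracket is left cancellative: for all $x,y,z\in B_\bullet$, $x[y]=x[z]$ implies $y=z$. -/

import Mathlib

/-- An LD-system: a set with a bracket `x, y ↦ x[y]` (here `br x y`) satisfying the left
self-distributivity law `x[y[z]] = x[y][x[z]]`. -/
def IsLDSystem {S : Type*} (br : S → S → S) : Prop :=
  ∀ x y z : S, br x (br y z) = br (br x y) (br x z)

/-- An augmented LD-system (ALD-system): an LD-system with a second operation `circ`
satisfying the two mixed laws. -/
structure IsALDSystem {S : Type*} (br circ : S → S → S) : Prop where
  ld : IsLDSystem br
  br_br : ∀ x y z : S, br x (br y z) = br (circ x y) z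
  br_circ : ∀ x y z : S, br x (circ y z) = circ (br x y) (br x z)

/-- Left cancellativity of a bracket: `x[y] = x[z]` implies `y = z`. -/
def IsLeftCancellativeBracket {S : Type*} (br : S → S → S) : Prop :=
  ∀ x y z : S, br x y = br x z → y = z

namespace ParenBraid

/-- The letters. Indices start from `0` here and from `1` in the usual notation:
`Gen.sigma i` is the letter `σ_{i+1}` and `Gen.a i` is the letter `a_{i+1}`. -/
inductive Gen : Type
  | sigma (i : ℕ) : Gen
  | a (i : ℕ) : Gen

/-- The letter `σ_{i+1}` in the free group. -/
def fs (i : ℕ) : FreeGroup Gen := FreeGroup.of (Gen.sigma i)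

/-- The letter `a_{i+1}` in the free group. -/
def fa (i : ℕ) : FreeGroup Gen := FreeGroup.of (Gen.a i)

/-- `DefRel u v` says that `u = v` is one of the defining relations. In the usual notation, for
`i ≥ 1` and `j ≥ i + 2`, these are
`σ_i σ_j = σ_j σ_i`, `σ_i a_j = a_j σ_i`, `a_i a_{j-1} = a_j a_i`, `a_i σ_{j-1} = σ_j a_i`,
`σ_i σ_{i+1} σ_i = σ_{i+1} σ_i σ_{i+1}`, `σ_{i+1} σ_i a_{i+1} = a_i σ_i`,
`σ_i σ_{i+1} a_i = a_{i+1} σ_i`.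
In the third and fourth families the Lean variable `k` plays the role of `j - 1`. -/
inductive DefRel : FreeGroup Gen → FreeGroup Gen → Prop
  | sigma_sigma (i j : ℕ) (h : i + 2 ≤ j) : DefRel (fs i * fs j) (fs j * fs i)
  | sigma_a (i j : ℕ) (h : i + 2 ≤ j) : DefRel (fs i * fa j) (fa j * fs i)
  | a_a (i k : ℕ) (h : i + 1 ≤ k) : DefRel (fa i * fa k) (fa (k + 1) * fa i)
  | a_sigma (i k : ℕ) (h : i + 1 ≤ k) : DefRel (fa i * fs k) (fs (k + 1) * fa i)
  | braid (i : ℕ) : DefRel (fs i * fs (i + 1) * fs i) (fs (i + 1) * fs i * fs (i + 1))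
  | cross_a (i : ℕ) : DefRel (fs (i + 1) * fs i * fa (i + 1)) (fa i * fs i)
  | cross_a' (i : ℕ) : DefRel (fs i * fs (i + 1) * fa i) (fa (i + 1) * fs i)

/-- The relators `u v⁻¹`, one for each defining relation `u = v`. -/
def rels : Set (FreeGroup Gen) := {r | ∃ u v, DefRel u v ∧ r = u * v⁻¹}

/-- The group of parenthesized braids, given by generators and relations. -/
abbrev BBullet : Type := PresentedGroup rels

/-- The element `σ_{i+1}`; in particular `sigma 0` is `σ_1`. -/
def sigma (i : ℕ) : BBullet := PresentedGroup.of (Gen.sigma i)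

/-- The element `a_{i+1}`; in particular `a 0` is `a_1`. -/
def a (i : ℕ) : BBullet := PresentedGroup.of (Gen.a i)

/-- The shift on letters. -/
def Gen.shift : Gen → Gen
  | .sigma i => .sigma (i + 1)
  | .a i => .a (i + 1)

/-- The shift preserves the defining relations. -/
theorem DefRel.map_shift {u v : FreeGroup Gen} (h : DefRel u v) :
    DefRel (FreeGroup.map Gen.shift u) (FreeGroup.map Gen.shift v) := by
  have hs : ∀ i, FreeGroup.map Gen.shift (fs i) = fs (i + 1) := fun _ => rfl
  have ha : ∀ i, FreeGroup.map Gen.shift (fa i) = fa (i + 1) := fun _ => rfl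
  cases h with
  | sigma_sigma i j h => simpa only [map_mul, hs, ha] using DefRel.sigma_sigma (i + 1) (j + 1) (by omega)
  | sigma_a i j h => simpa only [map_mul, hs, ha] using DefRel.sigma_a (i + 1) (j + 1) (by omega)
  | a_a i k h => simpa only [map_mul, hs, ha] using DefRel.a_a (i + 1) (k + 1) (by omega)
  | a_sigma i k h => simpa only [map_mul, hs, ha] using DefRel.a_sigma (i + 1) (k + 1) (by omega)
  | braid i => simpa only [map_mul, hs, ha] using DefRel.braid (i + 1)
  | cross_a i => simpa only [map_mul, hs, ha] using DefRel.cross_a (i + 1)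
  | cross_a' i => simpa only [map_mul, hs, ha] using DefRel.cross_a' (i + 1)

theorem lift_shift_eq_mk (u : FreeGroup Gen) :
    FreeGroup.lift (fun g => (PresentedGroup.of g.shift : BBullet)) u =
      PresentedGroup.mk rels (FreeGroup.map Gen.shift u) := by
  have : FreeGroup.lift (fun g => (PresentedGroup.of g.shift : BBullet)) =
      (PresentedGroup.mk rels).comp (FreeGroup.map Gen.shift) := by
    ext g
    simp [PresentedGroup.of]
  rw [this]
  rfl

/-- The shift endomorphism `∂`, the group endomorphism with `σ_i ↦ σ_{i+1}` and
`a_i ↦ a_{i+1}` for every `i`. -/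
def shift : BBullet →* BBullet :=
  PresentedGroup.toGroup (rels := rels) (f := fun g => (PresentedGroup.of g.shift : BBullet)) (by
    rintro r ⟨u, v, h, rfl⟩
    rw [lift_shift_eq_mk]
    apply PresentedGroup.one_of_mem
    exact ⟨_, _, h.map_shift, by simp⟩)

theorem shift_sigma (i : ℕ) : shift (sigma i) = sigma (i + 1) :=
  PresentedGroup.toGroup.of _

theorem shift_a (i : ℕ) : shift (a i) = a (i + 1) :=
  PresentedGroup.toGroup.of _

/-- The bracket `x[y] = x · ∂y · σ_1 · (∂x)⁻¹`. -/
def bracket (x y : BBullet) : BBullet := x * shift y * sigma 0 * (shift x)⁻¹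

/-- The operation `x ∘ y = x · ∂y · a_1`. -/
def circ (x y : BBullet) : BBullet := x * shift y * a 0

end ParenBraid

namespace ParenBraid

/-! The three identities are word computations. They rest on `σ_1 · ∂²x = ∂²x · σ_1` and `a_1 · ∂x =
∂²x · a_1`, each checked on letters; what remains is the braid relation for LD and one crossing
relation for each mixed law. Left cancellation amounts to injectivity of `∂`. With `c_n = σ_1 ⋯
σ_n`, one has `∂x · c_m = c_n · x` for all large `m`, `n` with `n - m = deg x`, where `deg` counts
the letters `a_i` with sign. If `∂x = 1`, then `deg x = deg ∂x = 0`, so `m = n` is allowed and `x =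
1`. -/

theorem DefRel.mk_eq {u v : FreeGroup Gen} (h : DefRel u v) :
    PresentedGroup.mk rels u = PresentedGroup.mk rels v := by
  have := PresentedGroup.one_of_mem (rels := rels) (x := u * v⁻¹) ⟨u, v, h, rfl⟩
  rwa [map_mul, map_inv, mul_inv_eq_one] at this

theorem sigma_mul_sigma {i j : ℕ} (h : i + 2 ≤ j) : sigma i * sigma j = sigma j * sigma i :=
  (DefRel.sigma_sigma i j h).mk_eq

theorem sigma_mul_a {i j : ℕ} (h : i + 2 ≤ j) : sigma i * a j = a j * sigma i :=
  (DefRel.sigma_a i j h).mk_eq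

theorem a_mul_a {i k : ℕ} (h : i + 1 ≤ k) : a i * a k = a (k + 1) * a i :=
  (DefRel.a_a i k h).mk_eq

theorem a_mul_sigma {i k : ℕ} (h : i + 1 ≤ k) : a i * sigma k = sigma (k + 1) * a i :=
  (DefRel.a_sigma i k h).mk_eq

theorem sigma_braid (i : ℕ) :
    sigma i * sigma (i + 1) * sigma i = sigma (i + 1) * sigma i * sigma (i + 1) :=
  (DefRel.braid i).mk_eq

theorem sigma_sigma_a_succ (i : ℕ) : sigma (i + 1) * sigma i * a (i + 1) = a i * sigma i :=
  (DefRel.cross_a i).mk_eq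

theorem sigma_sigma_a (i : ℕ) : sigma i * sigma (i + 1) * a i = a (i + 1) * sigma i :=
  (DefRel.cross_a' i).mk_eq

/-- Induction principle for the group of parenthesized braids. -/
theorem induction_generators {p : BBullet → Prop} (one : p 1) (sigma : ∀ i, p (sigma i))
    (a : ∀ i, p (a i)) (mul : ∀ x y, p x → p y → p (x * y)) (inv : ∀ x, p x → p x⁻¹)
    (x : BBullet) : p x := by
  induction x using PresentedGroup.induction_on with
  | _ w =>
    have hof : ∀ g : Gen, p (PresentedGroup.mk rels (FreeGroup.of g)) := by
      rintro (i | i)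
      · exact sigma i
      · exact a i
    induction w using FreeGroup.induction_on with
    | C1 => simpa using one
    | of g => exact hof g
    | inv_of g _ => rw [map_inv]; exact inv _ (hof g)
    | mul u v hu hv => rw [map_mul]; exact mul _ _ hu hv

/-- Two group homomorphisms on parenthesized braids that agree on the letters are equal. -/
theorem hom_ext {G : Type*} [Group G] {f g : BBullet →* G}
    (hs : ∀ i, f (sigma i) = g (sigma i)) (ha : ∀ i, f (a i) = g (a i)) : f = g := by
  ext (i | i)
  · exact hs i
  · exact ha i

/-- The image of `∂²` is generated by letters of index at least 3 (usual numbering), all of which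
commute with `σ_1`. -/
theorem sigma_zero_mul_shift_shift (x : BBullet) :
    sigma 0 * shift (shift x) = shift (shift x) * sigma 0 := by
  have : (MulAut.conj (sigma 0)).toMonoidHom.comp (shift.comp shift) = shift.comp shift := by
    refine hom_ext (fun i => ?_) (fun i => ?_)
    · simp only [MonoidHom.comp_apply, shift_sigma, MulEquiv.coe_toMonoidHom, MulAut.conj_apply]
      rw [sigma_mul_sigma (by omega), mul_inv_cancel_right]
    · simp only [MonoidHom.comp_apply, shift_a, MulEquiv.coe_toMonoidHom, MulAut.conj_apply]
      rw [sigma_mul_a (by omega), mul_inv_cancel_right]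
  exact mul_inv_eq_iff_eq_mul.mp (DFunLike.congr_fun this x)

theorem a_zero_mul_shift (x : BBullet) : a 0 * shift x = shift (shift x) * a 0 := by
  have : (MulAut.conj (a 0)).toMonoidHom.comp shift = shift.comp shift := by
    refine hom_ext (fun i => ?_) (fun i => ?_)
    · simp only [MonoidHom.comp_apply, shift_sigma, MulEquiv.coe_toMonoidHom, MulAut.conj_apply]
      rw [a_mul_sigma (by omega), mul_inv_cancel_right]
    · simp only [MonoidHom.comp_apply, shift_a, MulEquiv.coe_toMonoidHom, MulAut.conj_apply]
      rw [a_mul_a (by omega), mul_inv_cancel_right]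
  exact mul_inv_eq_iff_eq_mul.mp (DFunLike.congr_fun this x)

theorem isLDSystem_bracket : IsLDSystem bracket := by
  intro x y z
  simp only [bracket, map_mul, map_inv, shift_sigma]
  have h : sigma 1 * sigma 0 = sigma 0 * sigma 1 * sigma 0 * (sigma 1)⁻¹ := by
    rw [sigma_braid 0]; group
  have hx : (shift (shift x))⁻¹ * sigma 0 * shift (shift x) = sigma 0 := by
    rw [mul_assoc, sigma_zero_mul_shift_shift, inv_mul_cancel_left]
  have hy : (shift (shift y))⁻¹ * sigma 0 = sigma 0 * (shift (shift y))⁻¹ := by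
    rw [inv_mul_eq_iff_eq_mul, ← mul_assoc, ← sigma_zero_mul_shift_shift, mul_inv_cancel_right]
  calc _ = x * shift y * shift (shift z) * sigma 1 * ((shift (shift y))⁻¹ * sigma 0)
        * (shift x)⁻¹ := by group
    _ = x * shift y * shift (shift z) * (sigma 1 * sigma 0) * (shift (shift y))⁻¹
        * (shift x)⁻¹ := by rw [hy]; group
    _ = x * shift y * (shift (shift z) * sigma 0) * sigma 1 * sigma 0 * (sigma 1)⁻¹
        * (shift (shift y))⁻¹ * (shift x)⁻¹ := by rw [h]; group
    -- Inserting the conjugation by `∂²x` produces the inner factor `∂²x` of the shifted bracket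
    -- `∂(x[z])` and that of `(∂(x[y]))⁻¹`.
    _ = x * shift y * (sigma 0 * shift (shift z)) * sigma 1
        * ((shift (shift x))⁻¹ * sigma 0 * shift (shift x)) * (sigma 1)⁻¹
        * (shift (shift y))⁻¹ * (shift x)⁻¹ := by rw [hx, sigma_zero_mul_shift_shift]
    _ = _ := by group

theorem bracket_bracket (x y z : BBullet) :
    bracket x (bracket y z) = bracket (circ x y) z := by
  simp only [bracket, circ, map_mul, map_inv, shift_sigma, shift_a]
  have h : sigma 1 * sigma 0 = a 0 * sigma 0 * (a 1)⁻¹ := by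
    rw [← sigma_sigma_a_succ 0]; group
  have hy : (shift (shift y))⁻¹ * sigma 0 = sigma 0 * (shift (shift y))⁻¹ := by
    rw [inv_mul_eq_iff_eq_mul, ← mul_assoc, ← sigma_zero_mul_shift_shift, mul_inv_cancel_right]
  calc _ = x * shift y * shift (shift z) * sigma 1 * ((shift (shift y))⁻¹ * sigma 0)
        * (shift x)⁻¹ := by group
    _ = x * shift y * shift (shift z) * (sigma 1 * sigma 0) * (shift (shift y))⁻¹
        * (shift x)⁻¹ := by rw [hy]; group
    _ = x * shift y * (shift (shift z) * a 0) * sigma 0 * (a 1)⁻¹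
        * (shift (shift y))⁻¹ * (shift x)⁻¹ := by rw [h]; group
    _ = _ := by rw [← a_zero_mul_shift]; group

theorem bracket_circ (x y z : BBullet) :
    bracket x (circ y z) = circ (bracket x y) (bracket x z) := by
  simp only [bracket, circ, map_mul, map_inv, shift_sigma, shift_a]
  have hx : (shift (shift x))⁻¹ * a 0 = a 0 * (shift x)⁻¹ := by
    rw [inv_mul_eq_iff_eq_mul, ← mul_assoc, ← a_zero_mul_shift, mul_inv_cancel_right]
  calc _ = x * shift y * shift (shift z) * (a (0 + 1) * sigma 0) * (shift x)⁻¹ := by group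
    _ = x * shift y * (shift (shift z) * sigma 0) * sigma 1 * (a 0 * (shift x)⁻¹) := by
        rw [← sigma_sigma_a 0]; group
    _ = x * shift y * (sigma 0 * shift (shift z)) * sigma 1 * ((shift (shift x))⁻¹ * a 0) := by
        rw [hx, sigma_zero_mul_shift_shift]
    _ = _ := by group

/-- The degree of a letter: `0` for `σ_i` and `1` for `a_i`. -/
def Gen.degree : Gen → Multiplicative ℤ
  | .sigma _ => 1
  | .a _ => Multiplicative.ofAdd 1

/-- The algebraic number of letters `a_i` in a parenthesized braid. -/
def degree : BBullet →* Multiplicative ℤ :=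
  PresentedGroup.toGroup (rels := rels) (f := Gen.degree) (by
    rintro r ⟨u, v, h, rfl⟩
    -- Both sides of each relation contain equally many letters `a_i`.
    cases h <;> simp [fs, fa, Gen.degree])

theorem degree_sigma (i : ℕ) : degree (sigma i) = 1 :=
  PresentedGroup.toGroup.of _

theorem degree_a (i : ℕ) : degree (a i) = Multiplicative.ofAdd 1 :=
  PresentedGroup.toGroup.of _

theorem degree_shift (x : BBullet) : degree (shift x) = degree x := by
  have : degree.comp shift = degree :=
    hom_ext (fun i => by simp [shift_sigma, degree_sigma]) (fun i => by simp [shift_a, degree_a])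
  exact DFunLike.congr_fun this x

/-- The braid `σ_1 σ_2 ⋯ σ_n`. -/
def cycle : ℕ → BBullet
  | 0 => 1
  | n + 1 => cycle n * sigma n

theorem cycle_mul_sigma_of_lt {n i : ℕ} (h : n < i) : cycle n * sigma i = sigma i * cycle n := by
  induction n with
  | zero => simp [cycle]
  | succ n ih =>
    rw [cycle, mul_assoc, sigma_mul_sigma (by omega), ← mul_assoc, ih (by omega), mul_assoc]

theorem cycle_mul_a_of_lt {n i : ℕ} (h : n < i) : cycle n * a i = a i * cycle n := by
  induction n with
  | zero => simp [cycle]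
  | succ n ih =>
    rw [cycle, mul_assoc, sigma_mul_a (by omega), ← mul_assoc, ih (by omega), mul_assoc]

theorem cycle_mul_sigma {n i : ℕ} (h : i + 2 ≤ n) :
    cycle n * sigma i = sigma (i + 1) * cycle n := by
  induction n, h using Nat.le_induction with
  | base =>
    calc cycle (i + 2) * sigma i = cycle i * (sigma i * sigma (i + 1) * sigma i) := by
          simp only [cycle, mul_assoc]
      _ = cycle i * sigma (i + 1) * sigma i * sigma (i + 1) := by
          rw [sigma_braid]; simp only [mul_assoc]
      _ = _ := by rw [cycle_mul_sigma_of_lt (by omega)]; simp only [cycle, mul_assoc]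
  | succ n h ih =>
    rw [cycle, mul_assoc, ← sigma_mul_sigma h, ← mul_assoc, ih, mul_assoc]

/-- The crossing relation settles the shortest cycle; each further `σ` loses one index on passing `a
i`. This is why the two cycles differ in length, and why the degree enters below. -/
theorem cycle_succ_mul_a {n i : ℕ} (h : i + 1 ≤ n) :
    cycle (n + 1) * a i = a (i + 1) * cycle n := by
  induction n, h using Nat.le_induction with
  | base =>
    calc cycle (i + 2) * a i = cycle i * (sigma i * sigma (i + 1) * a i) := by
          simp only [cycle, mul_assoc]
      _ = cycle i * a (i + 1) * sigma i := by rw [sigma_sigma_a, mul_assoc]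
      _ = _ := by rw [cycle_mul_a_of_lt (by omega)]; simp only [cycle, mul_assoc]
  | succ n h ih =>
    rw [cycle, mul_assoc, ← a_mul_sigma h, ← mul_assoc, ih, cycle, mul_assoc]

/-- The shift is a conjugation by long cycles, up to the defect measured by the degree. -/
theorem shift_mul_cycle (x : BBullet) :
    ∃ N : ℕ, ∀ m n : ℕ, N ≤ m → N ≤ n → (n : ℤ) = m + (degree x).toAdd →
      shift x * cycle m = cycle n * x := by
  induction x using induction_generators with
  | one =>
    refine ⟨0, fun m n _ _ h => ?_⟩
    obtain rfl : n = m := by simpa using h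
    simp
  | sigma i =>
    refine ⟨i + 2, fun m n hm _ h => ?_⟩
    obtain rfl : n = m := by simpa [degree_sigma] using h
    rw [shift_sigma, cycle_mul_sigma hm]
  | a i =>
    refine ⟨i + 1, fun m n hm _ h => ?_⟩
    obtain rfl : n = m + 1 := by rw [degree_a, toAdd_ofAdd] at h; exact_mod_cast h
    rw [shift_a, cycle_succ_mul_a hm]
  | mul x y hx hy =>
    obtain ⟨N, hx⟩ := hx
    obtain ⟨K, hy⟩ := hy
    -- The extra `|deg y|` keeps the intermediate length `k = m + deg y` above both `N` and `K`.
    refine ⟨N + K + (degree y).toAdd.natAbs, fun m n hm hn h => ?_⟩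
    rw [map_mul, toAdd_mul] at h
    obtain ⟨k, hk⟩ : ∃ k : ℕ, (k : ℤ) = m + (degree y).toAdd :=
      ⟨(m + (degree y).toAdd).toNat, by omega⟩
    rw [map_mul, mul_assoc, hy m k (by omega) (by omega) hk, ← mul_assoc,
      hx k n (by omega) (by omega) (by omega), mul_assoc]
  | inv x hx =>
    obtain ⟨N, hx⟩ := hx
    refine ⟨N, fun m n hm hn h => ?_⟩
    rw [map_inv, toAdd_inv] at h
    rw [map_inv, inv_mul_eq_iff_eq_mul, ← mul_assoc, hx n m hn hm (by omega),
      mul_inv_cancel_right]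

theorem shift_injective : Function.Injective shift := by
  rw [injective_iff_map_eq_one]
  intro x hx
  have hd : degree x = 1 := by rw [← degree_shift, hx, map_one]
  obtain ⟨N, h⟩ := shift_mul_cycle x
  have := h N N le_rfl le_rfl (by simp [hd])
  rw [hx, one_mul] at this
  exact left_eq_mul.mp this

theorem isLeftCancellativeBracket_bracket : IsLeftCancellativeBracket bracket := by
  intro x y z h
  simp only [bracket, mul_left_inj, mul_right_inj] at h
  exact shift_injective h

end ParenBraid

theorem proposition3p5 :
    IsALDSystem ParenBraid.bracket ParenBraid.circ ∧
      IsLeftCancellativeBracket ParenBraid.bracket :=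
  ⟨⟨ParenBraid.isLDSystem_bracket, ParenBraid.bracket_bracket, ParenBraid.bracket_circ⟩,
    ParenBraid.isLeftCancellativeBracket_bracket⟩
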